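/- A simple game on a finite set $N$ of voters is a monotone family of winning coalitions $U\subseteq N$ for which $\emptyset$ is losing and $N$ is winning. It is weighted if there are non-negative real weights $w_i$ ($i\in N$) and a real quota $q$ such that a coalition $U$ is winning if and only if $\sum_{i\in U}w_i\ge q$. An integer representation $[q;w]$ of the game consists of an integer quota $q$ and non-negative integer weights $w_i$ such that $\sum_{i\in U}w_i\ge q$ for every winning coalition $U$ and $\sum_{i\in U}w_i\le q-1$ for every losing coalition $U$. It is a minimum integer representation if $w_i\le w_i'$ for all $i\in N$ and every integer representation $[q';w']$ of the same game. Voter $i$ is at least as influential as voter $j$ if, for every winning coalition $U$ with $j\in U$ and $i\notin U$, the coalition $(U\setminus\{j\})\cup\{i\}$ is winning. Voters $i$ and $j$ are of the same type if each is at least as influential as the other; the types are the equivalence classes of this relation. **Theorem.** Let $G$ be a weighted game with exactly two types of voters. Then the types can be named $N_1,N_2$ so that every voter in $N_1$ is strictly more influential than every voter in $N_2$; put $n_1=|N_1|$ and $n_2=|N_2|$. The game $G$ has exactly one minimum integer representation $[q;w]$. Its quota is also smallest, i.e. $q\le q'$ for every integer representation $[q';w']$ of $G$. All voters in $N_1$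 have the same weight $w_1$ in it, all voters in $N_2$ have the same weight $w_2$, and $$w_1\le\max(n_1+1,n_2),\qquad w_2\le\max(n_1,n_2-1),\qquad q\le(n_1+n_2)\cdot\max(n_1+1,n_2).$$ Call $(m_1,m_2)$ with $0\le m_k\le n_k$ a coalition vector; it is winning if the coalitions with $m_1$ members in $N_1$ and $m_2$ members in $N_2$ are winning. Let $\preceq$ be the partial order on coalition vectors generated by $(m_1-1,m_2)\preceq(m_1,m_2)$, $(m_1,m_2-1)\preceq(m_1,m_2)$ and $(m_1-1,m_2+1)\preceq(m_1,m_2)$, and let $r$ be the number of $\preceq$-minimal winning coalition vectors (the shift-minimal winning coalitions). If $r\ge 2$, then moreover $$1\le w_1\le n_2,\qquad 0\le w_2\le n_1,\qquad w_2+1\le q\le 2n_1n_2.$$ -/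

import Mathlib

/-- A simple game on the finite set of voters `N`: a monotone family of winning coalitions
such that the empty coalition loses and the grand coalition wins. -/
structure SimpleGame (N : Type*) [Fintype N] where
  /-- `wins U` says that the coalition `U` is winning, i.e. `χ(U) = 1`. -/
  wins : Finset N → Prop
  not_wins_empty : ¬ wins ∅
  wins_univ : wins Finset.univ
  mono : ∀ U V : Finset N, U ⊆ V → wins U → wins V

namespace SimpleGame

variable {N : Type*} [Fintype N] [DecidableEq N]

/-- `[q; w]` represents the game over the reals: the weights are non-negative, and a coalition is
winning if and only if its total weight equals or surpasses the quota. -/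
def IsRealRep (G : SimpleGame N) (q : ℝ) (w : N → ℝ) : Prop :=
  (∀ i, 0 ≤ w i) ∧ ∀ U : Finset N, G.wins U ↔ q ≤ ∑ i ∈ U, w i

/-- A simple game is weighted if it has a representation by non-negative weights and a quota. -/
def IsWeighted (G : SimpleGame N) : Prop :=
  ∃ (q : ℝ) (w : N → ℝ), G.IsRealRep q w

/-- `[q; w]` is an integer representation of the game: the weights are non-negative integers,
winning coalitions have weight at least `q` and losing ones have weight at most `q - 1`. -/
def IsIntegerRep (G : SimpleGame N) (q : ℤ) (w : N → ℤ) : Prop :=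
  (∀ i, 0 ≤ w i) ∧
  (∀ U : Finset N, G.wins U → q ≤ ∑ i ∈ U, w i) ∧
  (∀ U : Finset N, ¬ G.wins U → ∑ i ∈ U, w i ≤ q - 1)

/-- A minimum integer representation: each of its weights is at most the corresponding weight of
every integer representation of the same game. -/
def IsMinimumIntegerRep (G : SimpleGame N) (q : ℤ) (w : N → ℤ) : Prop :=
  G.IsIntegerRep q w ∧
  ∀ (q' : ℤ) (w' : N → ℤ), G.IsIntegerRep q' w' → ∀ i, w i ≤ w' i

/-- Isbell's desirability relation: `i` is at least as influential as `j` if replacing `j` by `i`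
never turns a winning coalition into a losing one. -/
def Desirable (G : SimpleGame N) (i j : N) : Prop :=
  ∀ U : Finset N, j ∈ U → i ∉ U → G.wins U → G.wins (insert i (U.erase j))

/-- Two voters are equivalent if each is at least as influential as the other. -/
def Equivalent (G : SimpleGame N) (i j : N) : Prop :=
  G.Desirable i j ∧ G.Desirable j i

open Classical in
/-- The type (equivalence class) of the voter `i`. -/
noncomputable def typeOf (G : SimpleGame N) (i : N) : Finset N :=
  Finset.univ.filter fun j => G.Equivalent i j

/-- The set of types of voters that occur in the game. -/
noncomputable def types (G : SimpleGame N) : Finset (Finset N) :=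
  Finset.univ.image G.typeOf

/-- `N₁` and `N₂` are the types of the game, and the voters in `N₁` are strictly more influential
than those in `N₂`. -/
def IsTypePair (G : SimpleGame N) (N₁ N₂ : Finset N) : Prop :=
  G.types = {N₁, N₂} ∧ ∀ i ∈ N₁, ∀ j ∈ N₂, G.Desirable i j ∧ ¬ G.Desirable j i

/-- The vector `m = (m₁, m₂)`, standing for the coalitions with `m₁` members in `N₁` and `m₂`
members in `N₂`, is winning. (If `N₁` and `N₂` are the types of the game, all these coalitions are
winning or all are losing.) -/
def VectorWins (G : SimpleGame N) (N₁ N₂ : Finset N) (m : ℕ × ℕ) : Prop :=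
  ∃ U : Finset N, (U ∩ N₁).card = m.1 ∧ (U ∩ N₂).card = m.2 ∧ G.wins U

/-- The coalition vectors `(m₁, m₂)` with `m₁ ≤ n₁` and `m₂ ≤ n₂`. -/
def coalitionVectors (n₁ n₂ : ℕ) : Finset (ℕ × ℕ) :=
  Finset.range (n₁ + 1) ×ˢ Finset.range (n₂ + 1)

/-- The generating relations of the shift order: `m` arises from the coalition vector `m'` by
dropping a voter of either type, or by replacing a voter of the first type by one of the second. -/
inductive ShiftStep (n₁ n₂ : ℕ) : ℕ × ℕ → ℕ × ℕ → Prop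
  | dropFirst (a b : ℕ) : a + 1 ≤ n₁ → b ≤ n₂ → ShiftStep n₁ n₂ (a, b) (a + 1, b)
  | dropSecond (a b : ℕ) : a ≤ n₁ → b + 1 ≤ n₂ → ShiftStep n₁ n₂ (a, b) (a, b + 1)
  | shift (a b : ℕ) : a + 1 ≤ n₁ → b + 1 ≤ n₂ → ShiftStep n₁ n₂ (a, b + 1) (a + 1, b)

/-- The shift order `m ⪯ m'` on coalition vectors, generated by `ShiftStep`. -/
def ShiftLE (n₁ n₂ : ℕ) : ℕ × ℕ → ℕ × ℕ → Prop :=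
  Relation.ReflTransGen (ShiftStep n₁ n₂)

open Classical in
/-- The set of shift-minimal winning coalitions: the coalition vectors that are minimal, with
respect to the shift order, among the winning ones. -/
noncomputable def shiftMinimalWinning (G : SimpleGame N) (N₁ N₂ : Finset N) : Finset (ℕ × ℕ) :=
  (coalitionVectors N₁.card N₂.card).filter fun m =>
    G.VectorWins N₁ N₂ m ∧
    ∀ m' ∈ coalitionVectors N₁.card N₂.card,
      G.VectorWins N₁ N₂ m' → ShiftLE N₁.card N₂.card m' m → m' = m

end SimpleGame

/-!
The two types of a weighted game are the classes of voters of larger and of smaller influence,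
`N₁` and `N₂`, and whether a coalition wins depends only on its numbers of members in each of them.
So the game is a set of winning points in the box `[0, n₁] × [0, n₂]`, and what matters are the
exchanges that change the outcome: `FirstBeats p r` says that somewhere in the box replacing `p`
voters of `N₁` by `r` voters of `N₂` turns a win into a loss, and `SecondBeats p r` that it turns a
loss into a win. Type-preserving weights `(w₁, w₂)` have to satisfy `p * w₁ ≥ r * w₂ + 1` in the
first case and `r * w₂ ≥ p * w₁ + 1` in the second.

Any weights of the game force `r / p < r' / p'` whenever `FirstBeats p r` and `SecondBeats p' r'`.
Unless the voters in `N₂` are null voters (where the weights `1` and `0` do), a Stern–Brocot search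
starting with the fractions `1 / 1` and `1 / 0` ends in a pair `FirstBeats p r`,
`SecondBeats p' r'` with `p * r' = r * p' + 1` whose mediant `(p + p', r + r')` changes no outcome
(`exists_unimodular_pair`). By unimodularity every exchange that would violate the weights
`w₁ = r + r'`, `w₂ = p + p'` is a sum of mediant steps and of steps of one of the two ends, none of
which changes the outcome in the required direction; so these weights represent the game
(`FirstBeats.weight_lt`, `SecondBeats.weight_lt`).

These weights are minimal even among representations with different weights inside a type:
the inequalities for `(p, r)` and `(p', r')` hold for all sets of voters of the given sizes.
Enumerating each type cyclically and adding them up over consecutive blocks, everything cancels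
except the weight of one voter (`sum_block_chain`). Since both inequalities are tight for
`(w₁, w₂)`, the quota is determined, and comparing the two tight exchanges inside the box gives
`w₁ ≤ n₂` and `w₂ ≤ n₁` (`weight_le_card`); the other bounds follow.
-/

namespace SimpleGame

open Finset

/-! ### Exchanges in a box -/

/-- Somewhere in the box `[0, n₁] × [0, n₂]`, replacing `p` voters of the first type by `r` voters
of the second turns a winning vector into a losing one. -/
def FirstBeats (n₁ n₂ : ℕ) (V : ℕ → ℕ → Prop) (p r : ℕ) : Prop :=
  ∃ x y, x + p ≤ n₁ ∧ y + r ≤ n₂ ∧ V (x + p) y ∧ ¬ V x (y + r)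

/-- Somewhere in the box `[0, n₁] × [0, n₂]`, replacing `p` voters of the first type by `r` voters
of the second turns a losing vector into a winning one. -/
def SecondBeats (n₁ n₂ : ℕ) (V : ℕ → ℕ → Prop) (p r : ℕ) : Prop :=
  ∃ x y, x + p ≤ n₁ ∧ y + r ≤ n₂ ∧ ¬ V (x + p) y ∧ V x (y + r)

section Exchange

variable {n₁ n₂ : ℕ} {V : ℕ → ℕ → Prop}

lemma FirstBeats.split {a c a' c' : ℕ} (h : FirstBeats n₁ n₂ V (a + a') (c + c')) :
    FirstBeats n₁ n₂ V a c ∨ FirstBeats n₁ n₂ V a' c' := by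
  obtain ⟨x, y, hx, hy, hw, hl⟩ := h
  by_cases hm : V (x + a') (y + c)
  · exact Or.inr ⟨x, y + c, by omega, by omega, hm, by rwa [add_assoc]⟩
  · exact Or.inl ⟨x + a', y, by omega, by omega,
      by rwa [show x + a' + a = x + (a + a') by omega], hm⟩

lemma SecondBeats.split {a c a' c' : ℕ} (h : SecondBeats n₁ n₂ V (a + a') (c + c')) :
    SecondBeats n₁ n₂ V a c ∨ SecondBeats n₁ n₂ V a' c' := by
  obtain ⟨x, y, hx, hy, hl, hw⟩ := h
  by_cases hm : V (x + a') (y + c)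
  · exact Or.inl ⟨x + a', y, by omega, by omega,
      by rwa [show x + a' + a = x + (a + a') by omega], hm⟩
  · exact Or.inr ⟨x, y + c, by omega, by omega, hm, by rwa [add_assoc]⟩

lemma FirstBeats.add_le {p r : ℕ} (h : FirstBeats n₁ n₂ V p r) : p + r ≤ n₁ + n₂ := by
  obtain ⟨x, y, hx, hy, -⟩ := h
  omega

lemma SecondBeats.add_le {p r : ℕ} (h : SecondBeats n₁ n₂ V p r) : p + r ≤ n₁ + n₂ := by
  obtain ⟨x, y, hx, hy, -⟩ := h
  omega

end Exchange

/-- If neither of two vectors has a property that passes from a sum to one of its summands, then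
no combination of the two has it. -/
lemma not_combination_of_split {A : ℕ → ℕ → Prop}
    (hsplit : ∀ a c a' c', A (a + a') (c + c') → A a c ∨ A a' c') (h0 : ¬ A 0 0)
    {a c a' c' : ℕ} (h : ¬ A a c) (h' : ¬ A a' c') (k l : ℕ) :
    ¬ A (k * a + l * a') (k * c + l * c') := by
  have mul : ∀ {a c : ℕ}, ¬ A a c → ∀ k : ℕ, ¬ A (k * a) (k * c) := by
    intro a c h k
    induction k with
    | zero => simpa using h0
    | succ k ih =>
      rw [Nat.succ_mul, Nat.succ_mul]
      exact fun hk => (hsplit _ _ _ _ hk).elim ih h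
  exact fun hkl => (hsplit _ _ _ _ hkl).elim (mul h k) (mul h' l)

/-- The Stern–Brocot search: two bounded sets of vectors, containing `(1, 1)` and `(0, 1)`, contain
a unimodular pair whose mediant lies in neither of them. -/
lemma exists_unimodular_pair {A B : ℕ → ℕ → Prop} (M : ℕ)
    (hA : ∀ p r, A p r → p + r ≤ M) (hB : ∀ p r, B p r → p + r ≤ M) (hA1 : A 1 1) (hB1 : B 0 1) :
    ∃ p r p' r', A p r ∧ B p' r' ∧ p * r' = r * p' + 1 ∧
      ¬ A (p + p') (r + r') ∧ ¬ B (p + p') (r + r') := by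
  have key : ∀ k p r p' r' : ℕ, A p r → B p' r' → p * r' = r * p' + 1 →
      M < p + r + p' + r' + k → ∃ p r p' r', A p r ∧ B p' r' ∧ p * r' = r * p' + 1 ∧
        ¬ A (p + p') (r + r') ∧ ¬ B (p + p') (r + r') := by
    intro k
    induction k with
    | zero =>
      intro p r p' r' hp hp' hdet hM
      refine ⟨p, r, p', r', hp, hp', hdet, fun h => ?_, fun h => ?_⟩
      · have := hA _ _ h
        omega
      · have := hB _ _ h
        omega
    | succ k ih =>
      intro p r p' r' hp hp' hdet hM
      have hp0 : 0 < p := Nat.pos_of_ne_zero fun h => by simp [h] at hdet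
      have hr0 : 0 < r' := Nat.pos_of_ne_zero fun h => by simp [h] at hdet
      by_cases hmA : A (p + p') (r + r')
      · exact ih _ _ _ _ hmA hp' (by rw [add_mul, add_mul, hdet, mul_comm r' p']; ring) (by omega)
      · by_cases hmB : B (p + p') (r + r')
        · exact ih _ _ _ _ hp hmB (by rw [mul_add, mul_add, hdet, mul_comm p r]; ring) (by omega)
        · exact ⟨p, r, p', r', hp, hp', hdet, hmA, hmB⟩
  exact key M 1 1 0 1 hA1 hB1 rfl (by omega)

section Weights

variable {n₁ n₂ : ℕ} {V : ℕ → ℕ → Prop}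

/-- The mediant weights satisfy every constraint of the first kind: a violating vector would lie in
the cone spanned by the mediant and the upper end `(p', r')`, hence be a combination of the two. -/
lemma FirstBeats.weight_lt
    (hsep : ∀ a c a' c', FirstBeats n₁ n₂ V a c → SecondBeats n₁ n₂ V a' c' → c * a' < a * c')
    {p r p' r' : ℕ} (hp' : SecondBeats n₁ n₂ V p' r') (hdet : p * r' = r * p' + 1)
    (hm : ¬ FirstBeats n₁ n₂ V (p + p') (r + r')) {a c : ℕ} (h : FirstBeats n₁ n₂ V a c) :
    c * (p + p') < a * (r + r') := by
  by_contra! hlt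
  obtain ⟨l, hl⟩ := Nat.exists_eq_add_of_le hlt
  obtain ⟨k, hk⟩ := Nat.exists_eq_add_of_le (hsep _ _ _ _ h hp').le
  have h0 : ¬ FirstBeats n₁ n₂ V 0 0 := fun h0 => by simpa using hsep _ _ _ _ h0 hp'
  have hu : ¬ FirstBeats n₁ n₂ V p' r' := fun hu => by
    have := hsep _ _ _ _ hu hp'
    rw [mul_comm] at this
    exact this.false
  have key := not_combination_of_split (fun _ _ _ _ => FirstBeats.split) h0 hm hu k l
  zify at hl hk hdet
  have ha : a = k * (p + p') + l * p' := by
    zify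
    linear_combination (p + p' : ℤ) * hk + (p' : ℤ) * hl - (a : ℤ) * hdet
  have hc : c = k * (r + r') + l * r' := by
    zify
    linear_combination (r + r' : ℤ) * hk + (r' : ℤ) * hl - (c : ℤ) * hdet
  rw [← ha, ← hc] at key
  exact key h

/-- The mediant weights satisfy every constraint of the second kind: a violating vector would lie
in the cone spanned by the mediant and the lower end `(p, r)`, hence be a combination of the two. -/
lemma SecondBeats.weight_lt
    (hsep : ∀ a c a' c', FirstBeats n₁ n₂ V a c → SecondBeats n₁ n₂ V a' c' → c * a' < a * c')
    {p r p' r' : ℕ} (hp : FirstBeats n₁ n₂ V p r) (hdet : p * r' = r * p' + 1)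
    (hm : ¬ SecondBeats n₁ n₂ V (p + p') (r + r')) {a c : ℕ} (h : SecondBeats n₁ n₂ V a c) :
    a * (r + r') < c * (p + p') := by
  by_contra! hlt
  obtain ⟨l, hl⟩ := Nat.exists_eq_add_of_le hlt
  obtain ⟨k, hk⟩ := Nat.exists_eq_add_of_le (hsep _ _ _ _ hp h).le
  have h0 : ¬ SecondBeats n₁ n₂ V 0 0 := fun h0 => by simpa using hsep _ _ _ _ hp h0
  have hu : ¬ SecondBeats n₁ n₂ V p r := fun hu => by
    have := hsep _ _ _ _ hp hu
    rw [mul_comm] at this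
    exact this.false
  have key := not_combination_of_split (fun _ _ _ _ => SecondBeats.split) h0 hm hu k l
  zify at hl hk hdet
  have ha : a = k * (p + p') + l * p := by
    zify
    linear_combination (p + p' : ℤ) * hk + (p : ℤ) * hl - (a : ℤ) * hdet
  have hc : c = k * (r + r') + l * r := by
    zify
    linear_combination (r + r' : ℤ) * hk + (r : ℤ) * hl - (c : ℤ) * hdet
  rw [← ha, ← hc] at key
  exact key h

/-- The two exchanges that determine the mediant weights pass through vectors of equal weight,
which differ by a multiple of `(p + p', -(r + r'))`. For both exchanges to fit into the box, its
sides must be at least `p + p'` and `r + r'`. -/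
lemma weight_le_card {p r p' r' : ℕ}
    (hrep : ∀ x y x' y', x ≤ n₁ → y ≤ n₂ → x' ≤ n₁ → y' ≤ n₂ → V x y → ¬ V x' y' →
      (r + r') * x' + (p + p') * y' + 1 ≤ (r + r') * x + (p + p') * y)
    (hp : FirstBeats n₁ n₂ V p r) (hp' : SecondBeats n₁ n₂ V p' r')
    (hdet : p * r' = r * p' + 1) : r + r' ≤ n₂ ∧ p + p' ≤ n₁ := by
  obtain ⟨x, y, hx, hy, hw, hl⟩ := hp
  obtain ⟨u, v, hu, hv, hl', hw'⟩ := hp'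
  have h1 := hrep _ _ _ _ hx (by omega) hu (by omega) hw hl'
  have h2 := hrep _ _ _ _ (by omega) hv (by omega) hy hw' hl
  zify at h1 h2 hdet
  have hE : ((r + r' : ℕ) : ℤ) * (x - (u + p')) = ((p + p' : ℕ) : ℤ) * (v - (y + r)) := by
    push_cast
    apply le_antisymm <;> linarith
  have hcop : IsCoprime ((p + p' : ℕ) : ℤ) ((r + r' : ℕ) : ℤ) :=
    ⟨-r, p, by push_cast; linear_combination hdet⟩
  obtain ⟨t, ht⟩ := hcop.dvd_of_dvd_mul_left ⟨_, hE⟩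
  have hpp : (0 : ℤ) < ((p + p' : ℕ) : ℤ) := by
    have : 0 < p := Nat.pos_of_ne_zero fun h => by
      subst h
      norm_num at hdet
      have : (0 : ℤ) ≤ r * p' := by positivity
      omega
    exact_mod_cast (by omega : 0 < p + p')
  have ht' : (v : ℤ) - (y + r) = ((r + r' : ℕ) : ℤ) * t := by
    apply mul_left_cancel₀ hpp.ne'
    rw [← hE, ht]
    ring
  have hrr : (0 : ℤ) ≤ ((r + r' : ℕ) : ℤ) := by positivity
  rcases lt_trichotomy t 0 with h | h | h
  · constructor
    · have : ((r + r' : ℕ) : ℤ) * t ≤ ((r + r' : ℕ) : ℤ) * (-1) :=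
        mul_le_mul_of_nonneg_left (by omega) hrr
      omega
    · have : ((p + p' : ℕ) : ℤ) * t ≤ ((p + p' : ℕ) : ℤ) * (-1) :=
        mul_le_mul_of_nonneg_left (by omega) hpp.le
      omega
  · subst h
    omega
  · constructor
    · have : ((r + r' : ℕ) : ℤ) * 1 ≤ ((r + r' : ℕ) : ℤ) * t :=
        mul_le_mul_of_nonneg_left (by omega) hrr
      omega
    · have : ((p + p' : ℕ) : ℤ) * 1 ≤ ((p + p' : ℕ) : ℤ) * t :=
        mul_le_mul_of_nonneg_left (by omega) hpp.le
      omega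

/-- The minimal type-preserving weights of a two-type game, with the exchanges that force them. In
the first alternative the voters of the second type are null voters. -/
lemma exists_weights
    (hsep : ∀ a c a' c', FirstBeats n₁ n₂ V a c → SecondBeats n₁ n₂ V a' c' → c * a' < a * c')
    (hmono : ∀ x y x' y', x ≤ x' → y ≤ y' → x' ≤ n₁ → y' ≤ n₂ → V x y → V x' y')
    (h11 : FirstBeats n₁ n₂ V 1 1) :
    ∃ w₁ w₂ : ℕ, 1 ≤ w₁ ∧ w₁ ≤ n₂ ∧ w₂ ≤ n₁ ∧
      (∀ x y x' y', x ≤ n₁ → y ≤ n₂ → x' ≤ n₁ → y' ≤ n₂ → V x y → ¬ V x' y' →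
        w₁ * x' + w₂ * y' + 1 ≤ w₁ * x + w₂ * y) ∧
      (∃ x y x' y', x ≤ n₁ ∧ y ≤ n₂ ∧ x' ≤ n₁ ∧ y' ≤ n₂ ∧ V x y ∧ ¬ V x' y' ∧
        w₁ * x' + w₂ * y' + 1 = w₁ * x + w₂ * y) ∧
      ((w₁ = 1 ∧ w₂ = 0) ∨ ∃ p r p' r', FirstBeats n₁ n₂ V p r ∧ SecondBeats n₁ n₂ V p' r' ∧
        p * r' = r * p' + 1 ∧ w₁ = r + r' ∧ w₂ = p + p') := by
  by_cases h01 : SecondBeats n₁ n₂ V 0 1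
  · obtain ⟨p, r, p', r', hp, hp', hdet, hmA, hmB⟩ := exists_unimodular_pair (n₁ + n₂)
      (fun _ _ h => FirstBeats.add_le h) (fun _ _ h => SecondBeats.add_le h) h11 h01
    have hp0 : 0 < p := Nat.pos_of_ne_zero fun h => by simp [h] at hdet
    have hr0 : 0 < r' := Nat.pos_of_ne_zero fun h => by simp [h] at hdet
    have hrep : ∀ x y x' y', x ≤ n₁ → y ≤ n₂ → x' ≤ n₁ → y' ≤ n₂ → V x y → ¬ V x' y' →
        (r + r') * x' + (p + p') * y' + 1 ≤ (r + r') * x + (p + p') * y := by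
      intro x y x' y' hx hy hx' hy' hw hl
      rcases le_total x x' with hxx | hxx
      · rcases le_total y y' with hyy | hyy
        · exact absurd (hmono _ _ _ _ hxx hyy hx' hy' hw) hl
        · obtain ⟨a, rfl⟩ := Nat.exists_eq_add_of_le hxx
          obtain ⟨c, rfl⟩ := Nat.exists_eq_add_of_le hyy
          have := SecondBeats.weight_lt hsep hp hdet hmB ⟨x, y', hx', hy, hl, hw⟩
          linarith [mul_comm a (r + r'), mul_comm c (p + p'), mul_add (r + r') x a,
            mul_add (p + p') y' c]
      · obtain ⟨a, rfl⟩ := Nat.exists_eq_add_of_le hxx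
        rcases le_total y y' with hyy | hyy
        · obtain ⟨c, rfl⟩ := Nat.exists_eq_add_of_le hyy
          have := FirstBeats.weight_lt hsep hp' hdet hmA ⟨x', y, hx, hy', hw, hl⟩
          linarith [mul_comm a (r + r'), mul_comm c (p + p'), mul_add (r + r') x' a,
            mul_add (p + p') y c]
        · obtain ⟨c, rfl⟩ := Nat.exists_eq_add_of_le hyy
          have hac : 0 < a + c := Nat.pos_of_ne_zero fun h => hl (by
            obtain ⟨rfl, rfl⟩ : a = 0 ∧ c = 0 := by omega
            exact hw)
          have h1 : a ≤ (r + r') * a := Nat.le_mul_of_pos_left _ (by omega)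
          have h2 : c ≤ (p + p') * c := Nat.le_mul_of_pos_left _ (by omega)
          rw [mul_add, mul_add]
          omega
    obtain ⟨hb1, hb2⟩ := weight_le_card hrep hp hp' hdet
    refine ⟨r + r', p + p', by omega, hb1, hb2, hrep, ?_,
      Or.inr ⟨p, r, p', r', hp, hp', hdet, rfl, rfl⟩⟩
    obtain ⟨x, y, hx, hy, hw, hl⟩ := hp
    refine ⟨x + p, y, x, y + r, hx, by omega, by omega, hy, hw, hl, ?_⟩
    zify at hdet ⊢
    linear_combination -hdet
  · have hnull : ∀ x y, x ≤ n₁ → y ≤ n₂ → V x y → V x 0 := by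
      intro x y hx hy hw
      induction y with
      | zero => exact hw
      | succ y ih =>
        refine ih (by omega) ?_
        by_contra hl
        exact h01 ⟨x, y, hx, hy, hl, hw⟩
    have hn : 1 ≤ n₂ := by
      obtain ⟨x, y, hx, hy, -⟩ := h11
      omega
    refine ⟨1, 0, le_rfl, hn, Nat.zero_le _, ?_, ?_, Or.inl ⟨rfl, rfl⟩⟩
    · intro x y x' y' hx hy hx' hy' hw hl
      by_contra! hlt
      exact hl (hmono x 0 x' y' (by omega) (Nat.zero_le _) hx' hy' (hnull x y hx hy hw))
    · obtain ⟨x, y, hx, hy, hw, hl⟩ := h11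
      exact ⟨x + 1, y, x, y + 1, hx, by omega, by omega, hy, hw, hl, by ring⟩

end Weights

/-! ### Sums over consecutive blocks -/

lemma sum_block_iterate {g h : ℕ → ℝ} {ε : ℝ} {p r : ℕ}
    (H : ∀ s u, ∑ t ∈ Ico u (u + r), h t + ε ≤ ∑ t ∈ Ico s (s + p), g t) (k s u : ℕ) :
    ∑ t ∈ Ico u (u + k * r), h t + k * ε ≤ ∑ t ∈ Ico s (s + k * p), g t := by
  induction k with
  | zero => simp
  | succ k ih =>
    rw [Nat.succ_mul, Nat.succ_mul, ← add_assoc, ← add_assoc,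
      ← sum_Ico_consecutive h (Nat.le_add_right u (k * r)) (Nat.le_add_right _ r),
      ← sum_Ico_consecutive g (Nat.le_add_right s (k * p)) (Nat.le_add_right _ p)]
    have := H (s + k * p) (u + k * r)
    push_cast
    linarith

/-- If blocks of `p` terms of `g` exceed blocks of `r` terms of `h`, and blocks of `r'` terms of `h`
exceed blocks of `p'` terms of `g`, each time by `ε`, then `h` can be eliminated. -/
lemma sum_block_chain {g h : ℕ → ℝ} {ε : ℝ} {p r p' r' : ℕ}
    (hA : ∀ s u, ∑ t ∈ Ico u (u + r), h t + ε ≤ ∑ t ∈ Ico s (s + p), g t)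
    (hB : ∀ u s, ∑ t ∈ Ico s (s + p'), g t + ε ≤ ∑ t ∈ Ico u (u + r'), h t) (s s' : ℕ) :
    ∑ t ∈ Ico s' (s' + r * p'), g t + (r + r') * ε ≤ ∑ t ∈ Ico s (s + r' * p), g t := by
  have h1 := sum_block_iterate hA r' s 0
  have h2 := sum_block_iterate hB r 0 s'
  rw [mul_comm r' r] at h1
  linarith

/-- In the unimodular case only one term of `g` survives the elimination. -/
lemma le_of_sum_block_chain {g h : ℕ → ℝ} {ε : ℝ} {p r p' r' : ℕ}
    (hA : ∀ s u, ∑ t ∈ Ico u (u + r), h t + ε ≤ ∑ t ∈ Ico s (s + p), g t)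
    (hB : ∀ u s, ∑ t ∈ Ico s (s + p'), g t + ε ≤ ∑ t ∈ Ico u (u + r'), h t)
    (hdet : r' * p = r * p' + 1) (s : ℕ) : (r + r') * ε ≤ g s := by
  have := sum_block_chain hA hB s (s + 1)
  rw [hdet, ← sum_Ico_consecutive g (Nat.le_succ s)
    (show s + 1 ≤ s + (r * p' + 1) by omega)] at this
  rw [show s + (r * p' + 1) = s + 1 + r * p' by ring] at this
  simp only [Nat.succ_eq_add_one, Nat.Ico_succ_singleton, sum_singleton] at this
  linarith

/-- A cyclic enumeration of a non-empty finite set: each of its windows of length at most the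
cardinality is injective. -/
lemma exists_cyclic_enumeration {N : Type*} (S : Finset N) (hS : S.Nonempty) :
    ∃ e : ℕ → N, (∀ t, e t ∈ S) ∧ (∀ i ∈ S, ∃ t, e t = i) ∧
      ∀ s p, p ≤ S.card → Set.InjOn e (Ico s (s + p)) := by
  have hc : 0 < S.card := hS.card_pos
  refine ⟨fun t => (S.equivFin.symm ⟨t % S.card, Nat.mod_lt _ hc⟩ : S), fun t => by simp,
    fun i hi => ⟨S.equivFin ⟨i, hi⟩, ?_⟩, fun s p hp t ht t' ht' h => ?_⟩
  · simp [Nat.mod_eq_of_lt]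
  · have h2 : t % S.card = t' % S.card := by
      simpa using h
    refine Nat.mod_injOn_Ico s S.card ?_ ?_ h2
    · simp only [coe_Ico, Set.mem_Ico] at ht ⊢
      omega
    · simp only [coe_Ico, Set.mem_Ico] at ht' ⊢
      omega

/-! ### Weights and exchanges of voters -/

lemma exists_disjoint_subset_card_eq {N : Type*} [DecidableEq N] {S P : Finset N} (hP : P ⊆ S)
    {x : ℕ} (hx : x + P.card ≤ S.card) :
    ∃ X ⊆ S, Disjoint X P ∧ X.card = x := by
  have : x ≤ (S \ P).card := by
    rw [card_sdiff_of_subset hP]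
    omega
  obtain ⟨X, hX, hXc⟩ := exists_subset_card_eq this
  exact ⟨X, hX.trans sdiff_subset, disjoint_of_subset_left hX sdiff_disjoint, hXc⟩

lemma sum_insert_erase {N : Type*} [DecidableEq N] (w : N → ℝ) {U : Finset N} {i j : N} (hj : j ∈ U)
    (hi : i ∉ U) :
    ∑ k ∈ insert i (U.erase j), w k + w j = ∑ k ∈ U, w k + w i := by
  rw [sum_insert (fun h => hi (mem_of_mem_erase h)), ← sum_erase_add U w hj]
  ring

lemma card_insert_erase_inter {N : Type*} [DecidableEq N] {U S : Finset N} {i j : N} (hj : j ∈ U)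
    (hi : i ∉ U)
    (hij : i ∈ S ↔ j ∈ S) : (insert i (U.erase j) ∩ S).card = (U ∩ S).card := by
  by_cases hS : i ∈ S
  · have hjS := hij.1 hS
    rw [insert_inter_of_mem hS, erase_inter, card_insert_of_notMem (by simp [hi]),
      card_erase_add_one (by simp [hj, hjS])]
  · have hjS : j ∉ S := fun h => hS (hij.2 h)
    rw [insert_inter_of_notMem hS, erase_inter, erase_eq_of_notMem (by simp [hjS])]

section Game

variable {N : Type*} [Fintype N]

/-- The non-negative weights `w` separate winning from losing coalitions with margin `ε`. -/
def IsSeparating (G : SimpleGame N) (ε : ℝ) (w : N → ℝ) : Prop :=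
  (∀ i, 0 ≤ w i) ∧ ∀ U U', G.wins U → ¬ G.wins U' → ∑ i ∈ U', w i + ε ≤ ∑ i ∈ U, w i

lemma IsWeighted.exists_isSeparating {G : SimpleGame N} (hG : G.IsWeighted) :
    ∃ ε w, 0 < ε ∧ G.IsSeparating ε w := by
  classical
  obtain ⟨q, w, h0, hw⟩ := hG
  obtain ⟨L, hL, hmax⟩ := exists_max_image (univ.filter fun U => ¬ G.wins U)
    (fun U => ∑ i ∈ U, w i) ⟨∅, by simp [G.not_wins_empty]⟩
  have hL' : ∑ i ∈ L, w i < q := by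
    have := (mem_filter.1 hL).2
    rwa [hw, not_le] at this
  refine ⟨q - ∑ i ∈ L, w i, w, by linarith, h0, fun U U' hU hU' => ?_⟩
  have h1 := hmax U' (by simp [hU'])
  have h2 := (hw U).1 hU
  linarith

lemma IsIntegerRep.isSeparating {G : SimpleGame N} {q : ℤ} {w : N → ℤ}
    (h : G.IsIntegerRep q w) : G.IsSeparating 1 fun i => (w i : ℝ) := by
  refine ⟨fun i => Int.cast_nonneg (h.1 i), fun U U' hU hU' => ?_⟩
  beta_reduce
  have h1 := h.2.1 U hU
  have h2 := h.2.2 U' hU'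
  have : ∑ i ∈ U', w i + 1 ≤ ∑ i ∈ U, w i := by omega
  exact_mod_cast this

variable [DecidableEq N]

/-- The outcome depends only on the numbers of members in `N₁` and `N₂`, as given by `V`. -/
structure IsGrid (G : SimpleGame N) (N₁ N₂ : Finset N) (V : ℕ → ℕ → Prop) : Prop where
  disjoint : Disjoint N₁ N₂
  union : N₁ ∪ N₂ = univ
  wins_iff : ∀ U, G.wins U ↔ V (U ∩ N₁).card (U ∩ N₂).card

namespace IsGrid

variable {G : SimpleGame N} {N₁ N₂ : Finset N} {V : ℕ → ℕ → Prop}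

lemma sum_eq {M : Type*} [AddCommMonoid M] (h : G.IsGrid N₁ N₂ V) (w : N → M) (U : Finset N) :
    ∑ i ∈ U, w i = ∑ i ∈ U ∩ N₁, w i + ∑ i ∈ U ∩ N₂, w i := by
  rw [← sum_union (h.disjoint.mono inter_subset_right inter_subset_right),
    ← inter_union_distrib_left, h.union, inter_univ]

lemma union_inter (h : G.IsGrid N₁ N₂ V) {P R : Finset N} (hP : P ⊆ N₁) (hR : R ⊆ N₂) :
    (P ∪ R) ∩ N₁ = P ∧ (P ∪ R) ∩ N₂ = R := by
  have h1 : R ∩ N₁ = ∅ := disjoint_iff_inter_eq_empty.1 (h.disjoint.symm.mono_left hR)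
  have h2 : P ∩ N₂ = ∅ := disjoint_iff_inter_eq_empty.1 (h.disjoint.mono_left hP)
  rw [union_inter_distrib_right, union_inter_distrib_right, h1, h2,
    inter_eq_left.2 hP, inter_eq_left.2 hR, union_empty, empty_union]
  exact ⟨rfl, rfl⟩

lemma wins_union_iff (h : G.IsGrid N₁ N₂ V) {P R : Finset N} (hP : P ⊆ N₁) (hR : R ⊆ N₂) :
    G.wins (P ∪ R) ↔ V P.card R.card := by
  rw [h.wins_iff, (h.union_inter hP hR).1, (h.union_inter hP hR).2]

lemma mono (h : G.IsGrid N₁ N₂ V) (x y x' y' : ℕ) (hx : x ≤ x') (hy : y ≤ y')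
    (hx' : x' ≤ N₁.card) (hy' : y' ≤ N₂.card) (hV : V x y) : V x' y' := by
  obtain ⟨P', hP', rfl⟩ := exists_subset_card_eq hx'
  obtain ⟨R', hR', rfl⟩ := exists_subset_card_eq hy'
  obtain ⟨P, hP, rfl⟩ := exists_subset_card_eq hx
  obtain ⟨R, hR, rfl⟩ := exists_subset_card_eq hy
  rw [← h.wins_union_iff hP' hR']
  rw [← h.wins_union_iff (hP.trans hP') (hR.trans hR')] at hV
  exact G.mono _ _ (union_subset_union hP hR) hV

/-- An exchange that occurs anywhere in the box can be carried out with any voters. -/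
lemma sum_lt_of_firstBeats (h : G.IsGrid N₁ N₂ V) {ε : ℝ} {w : N → ℝ} (hw : G.IsSeparating ε w)
    {P R : Finset N} (hP : P ⊆ N₁) (hR : R ⊆ N₂)
    (hb : FirstBeats N₁.card N₂.card V P.card R.card) :
    ∑ i ∈ R, w i + ε ≤ ∑ i ∈ P, w i := by
  obtain ⟨x, y, hx, hy, hV, hV'⟩ := hb
  obtain ⟨X, hX, hXP, rfl⟩ := exists_disjoint_subset_card_eq hP hx
  obtain ⟨Y, hY, hYR, rfl⟩ := exists_disjoint_subset_card_eq hR hy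
  rw [← card_union_of_disjoint hXP, ← h.wins_union_iff (union_subset hX hP) hY] at hV
  rw [← card_union_of_disjoint hYR, ← h.wins_union_iff hX (union_subset hY hR)] at hV'
  have := hw.2 _ _ hV hV'
  rw [sum_union (h.disjoint.mono hX (union_subset hY hR)), sum_union hYR,
    sum_union (h.disjoint.mono (union_subset hX hP) hY), sum_union hXP] at this
  linarith

lemma sum_lt_of_secondBeats (h : G.IsGrid N₁ N₂ V) {ε : ℝ} {w : N → ℝ}
    (hw : G.IsSeparating ε w) {P R : Finset N} (hP : P ⊆ N₁) (hR : R ⊆ N₂)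
    (hb : SecondBeats N₁.card N₂.card V P.card R.card) :
    ∑ i ∈ P, w i + ε ≤ ∑ i ∈ R, w i := by
  obtain ⟨x, y, hx, hy, hV', hV⟩ := hb
  obtain ⟨X, hX, hXP, rfl⟩ := exists_disjoint_subset_card_eq hP hx
  obtain ⟨Y, hY, hYR, rfl⟩ := exists_disjoint_subset_card_eq hR hy
  rw [← card_union_of_disjoint hXP, ← h.wins_union_iff (union_subset hX hP) hY] at hV'
  rw [← card_union_of_disjoint hYR, ← h.wins_union_iff hX (union_subset hY hR)] at hV
  have := hw.2 _ _ hV hV'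
  rw [sum_union (h.disjoint.mono hX (union_subset hY hR)), sum_union hYR,
    sum_union (h.disjoint.mono (union_subset hX hP) hY), sum_union hXP] at this
  linarith

/-- Along cyclic enumerations of the two types, the constraints become inequalities between sums
over consecutive blocks. -/
lemma exists_enumerations (h : G.IsGrid N₁ N₂ V) (h₁ : N₁.Nonempty) (h₂ : N₂.Nonempty) {ε : ℝ}
    {w : N → ℝ} (hw : G.IsSeparating ε w) :
    ∃ e f : ℕ → N, (∀ i ∈ N₁, ∃ t, e t = i) ∧ (∀ i ∈ N₂, ∃ t, f t = i) ∧
      (∀ p r, FirstBeats N₁.card N₂.card V p r → ∀ s u,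
        ∑ t ∈ Ico u (u + r), w (f t) + ε ≤ ∑ t ∈ Ico s (s + p), w (e t)) ∧
      (∀ p r, SecondBeats N₁.card N₂.card V p r → ∀ u s,
        ∑ t ∈ Ico s (s + p), w (e t) + ε ≤ ∑ t ∈ Ico u (u + r), w (f t)) := by
  obtain ⟨e, he, he', hei⟩ := exists_cyclic_enumeration N₁ h₁
  obtain ⟨f, hf, hf', hfi⟩ := exists_cyclic_enumeration N₂ h₂
  have hes : ∀ s p, (Ico s (s + p)).image e ⊆ N₁ := fun s p i hi => by
    obtain ⟨t, -, rfl⟩ := mem_image.1 hi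
    exact he t
  have hfs : ∀ s p, (Ico s (s + p)).image f ⊆ N₂ := fun s p i hi => by
    obtain ⟨t, -, rfl⟩ := mem_image.1 hi
    exact hf t
  refine ⟨e, f, he', hf', fun p r hb s u => ?_, fun p r hb u s => ?_⟩
  · obtain ⟨x, y, hx, hy, -⟩ := id hb
    have hie := hei s p (by omega)
    have hif := hfi u r (by omega)
    rw [← sum_image hie, ← sum_image hif]
    refine h.sum_lt_of_firstBeats hw (hes _ _) (hfs _ _) ?_
    rw [card_image_of_injOn hie, card_image_of_injOn hif]
    simpa using hb
  · obtain ⟨x, y, hx, hy, -⟩ := id hb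
    have hie := hei s p (by omega)
    have hif := hfi u r (by omega)
    rw [← sum_image hie, ← sum_image hif]
    refine h.sum_lt_of_secondBeats hw (hes _ _) (hfs _ _) ?_
    rw [card_image_of_injOn hie, card_image_of_injOn hif]
    simpa using hb

/-- The exchange ratios of the two kinds are separated, since the game has weights. -/
lemma mul_lt_mul_of_beats (h : G.IsGrid N₁ N₂ V) (h₁ : N₁.Nonempty) (h₂ : N₂.Nonempty) {ε : ℝ}
    (hε : 0 < ε) {w : N → ℝ} (hw : G.IsSeparating ε w) (p r p' r' : ℕ)
    (hb : FirstBeats N₁.card N₂.card V p r) (hb' : SecondBeats N₁.card N₂.card V p' r') :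
    r * p' < p * r' := by
  obtain ⟨e, f, -, -, hA, hB⟩ := h.exists_enumerations h₁ h₂ hw
  have hr' : 0 < r' := Nat.pos_of_ne_zero fun h0 => by
    have h1 := hB p' r' hb' 0 0
    have h2 : 0 ≤ ∑ t ∈ Ico 0 (0 + p'), w (e t) := sum_nonneg fun t _ => hw.1 _
    simp only [h0, add_zero, Ico_self, sum_empty] at h1
    linarith
  by_contra! hle
  have h1 := sum_block_chain (hA p r hb) (hB p' r' hb') 0 0
  have h2 : ∑ t ∈ Ico 0 (0 + r' * p), w (e t) ≤ ∑ t ∈ Ico 0 (0 + r * p'), w (e t) :=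
    sum_le_sum_of_subset_of_nonneg
      (Ico_subset_Ico_right (by rw [mul_comm r' p]; omega)) fun t _ _ => hw.1 _
  have h3 : 0 < ((r : ℝ) + r') * ε := by
    have : (0 : ℝ) < r' := by exact_mod_cast hr'
    positivity
  linarith

/-- A unimodular pair of exchanges bounds the weight of every single voter from below. -/
lemma le_weight (h : G.IsGrid N₁ N₂ V) (h₁ : N₁.Nonempty) (h₂ : N₂.Nonempty) {q : ℤ} {w : N → ℤ}
    (hw : G.IsIntegerRep q w) {p r p' r' : ℕ} (hb : FirstBeats N₁.card N₂.card V p r)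
    (hb' : SecondBeats N₁.card N₂.card V p' r') (hdet : p * r' = r * p' + 1) :
    (∀ i ∈ N₁, ((r + r' : ℕ) : ℤ) ≤ w i) ∧ ∀ i ∈ N₂, ((p + p' : ℕ) : ℤ) ≤ w i := by
  obtain ⟨e, f, he, hf, hA, hB⟩ := h.exists_enumerations h₁ h₂ hw.isSeparating
  constructor
  · intro i hi
    obtain ⟨t, rfl⟩ := he i hi
    have := le_of_sum_block_chain (hA p r hb) (hB p' r' hb') (by rw [← hdet, mul_comm]) t
    rw [mul_one] at this
    exact_mod_cast this
  · intro i hi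
    obtain ⟨t, rfl⟩ := hf i hi
    have := le_of_sum_block_chain (hB p' r' hb') (hA p r hb) (by rw [hdet, mul_comm]) t
    rw [mul_one, add_comm] at this
    exact_mod_cast this

end IsGrid

/-! ### The influence relation and the types -/

lemma Desirable.refl (G : SimpleGame N) (i : N) : G.Desirable i i :=
  fun _ hi hi' => absurd hi hi'

lemma Desirable.trans {G : SimpleGame N} {i j k : N} (hij : G.Desirable i j)
    (hjk : G.Desirable j k) : G.Desirable i k := by
  intro U hk hi hU
  have hik : i ≠ k := fun h => hi (h ▸ hk)
  rcases eq_or_ne j k with rfl | hjk'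
  · exact hij U hk hi hU
  rcases eq_or_ne i j with rfl | hij'
  · exact hjk U hk hi hU
  by_cases hj : j ∈ U
  · have h1 := hjk (insert i (U.erase j)) (by simp [hk, hjk'.symm]) (by simp [hij'.symm])
      (hij U hj hi hU)
    convert h1 using 1
    ext l
    simp only [mem_insert, mem_erase]
    by_cases hlj : l = j
    · subst hlj
      simp [hj, hjk']
    · by_cases hlk : l = k
      · subst hlk
        simp [hlj, hik.symm]
      · simp [hlj, hlk]
  · have h1 := hij (insert j (U.erase k)) (by simp) (by simp [hi, hij']) (hjk U hk hj hU)
    convert h1 using 1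
    ext l
    simp only [mem_insert, mem_erase]
    by_cases hlj : l = j
    · subst hlj
      simp [hj]
    · simp [hlj]

lemma Equivalent.trans {G : SimpleGame N} {i j k : N} (h : G.Equivalent i j)
    (h' : G.Equivalent j k) : G.Equivalent i k :=
  ⟨h.1.trans h'.1, h'.2.trans h.2⟩

lemma Equivalent.symm {G : SimpleGame N} {i j : N} (h : G.Equivalent i j) : G.Equivalent j i :=
  ⟨h.2, h.1⟩

lemma mem_typeOf {G : SimpleGame N} {i j : N} : j ∈ G.typeOf i ↔ G.Equivalent i j := by
  simp [typeOf]

lemma typeOf_eq {G : SimpleGame N} {i j : N} (h : G.Equivalent i j) : G.typeOf i = G.typeOf j := by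
  ext k
  rw [mem_typeOf, mem_typeOf]
  exact ⟨fun hk => h.symm.trans hk, fun hk => h.trans hk⟩

lemma IsWeighted.desirable_total {G : SimpleGame N} (hG : G.IsWeighted) (i j : N) :
    G.Desirable i j ∨ G.Desirable j i := by
  obtain ⟨q, w, -, hw⟩ := hG
  have key : ∀ i j, w j ≤ w i → G.Desirable i j := by
    intro i j hij U hj hi hU
    rw [hw] at hU ⊢
    linarith [sum_insert_erase w hj hi]
  exact (le_total (w j) (w i)).imp (key i j) (key j i)

lemma IsWeighted.exists_isTypePair {G : SimpleGame N} (hG : G.IsWeighted)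
    (h_two : G.types.card = 2) :
    ∃ i j, G.IsTypePair (G.typeOf i) (G.typeOf j) := by
  obtain ⟨S, T, hST, hT⟩ := card_eq_two.1 h_two
  obtain ⟨i, -, rfl⟩ := mem_image.1 (show S ∈ G.types by simp [hT])
  obtain ⟨j, -, rfl⟩ := mem_image.1 (show T ∈ G.types by simp [hT])
  have key : ∀ i j, G.typeOf i ≠ G.typeOf j → G.Desirable i j →
      ∀ k ∈ G.typeOf i, ∀ l ∈ G.typeOf j, G.Desirable k l ∧ ¬ G.Desirable l k := by
    intro i j hne hij k hk l hl
    rw [mem_typeOf] at hk hl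
    exact ⟨(hk.2.trans hij).trans hl.1,
      fun hlk => hne (typeOf_eq ⟨hij, (hl.1.trans hlk).trans hk.2⟩)⟩
  rcases hG.desirable_total i j with h | h
  · exact ⟨i, j, hT, key i j hST h⟩
  · exact ⟨j, i, by rw [hT, pair_comm], key j i hST.symm h⟩

/-- Coalitions with the same numbers of members of each type can be transformed into each other by
exchanging equivalent voters one at a time. -/
lemma wins_of_card_inter_eq {G : SimpleGame N} {N₁ N₂ : Finset N} (hu : N₁ ∪ N₂ = univ)
    (hd : Disjoint N₁ N₂) (h₁ : ∀ i ∈ N₁, ∀ j ∈ N₁, G.Desirable i j)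
    (h₂ : ∀ i ∈ N₂, ∀ j ∈ N₂, G.Desirable i j) (U' : Finset N) :
    ∀ (n : ℕ) (U : Finset N), (U \ U').card = n → (U ∩ N₁).card = (U' ∩ N₁).card →
      (U ∩ N₂).card = (U' ∩ N₂).card → G.wins U → G.wins U' := by
  intro n
  induction n with
  | zero =>
    intro U hn _ _ hU
    exact G.mono _ _ (sdiff_eq_empty_iff_subset.1 (card_eq_zero.1 hn)) hU
  | succ n ih =>
    intro U hn hc₁ hc₂ hU
    obtain ⟨j, hj⟩ : (U \ U').Nonempty := card_pos.1 (by omega)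
    obtain ⟨hjU, hjU'⟩ := mem_sdiff.1 hj
    have find : ∀ S : Finset N, j ∈ S → (U ∩ S).card = (U' ∩ S).card →
        ∃ i ∈ S, i ∈ U' ∧ i ∉ U := by
      intro S hjS hc
      by_contra! hno
      have hss : U' ∩ S ⊂ U ∩ S := by
        refine (ssubset_iff_of_subset fun k hk => ?_).2 ⟨j, by simp [hjU, hjS], by simp [hjU']⟩
        obtain ⟨hk1, hk2⟩ := mem_inter.1 hk
        exact mem_inter.2 ⟨hno k hk2 hk1, hk2⟩
      exact (card_lt_card hss).ne hc.symm
    have step : ∀ i, i ∈ U' → i ∉ U → (i ∈ N₁ ↔ j ∈ N₁) → (i ∈ N₂ ↔ j ∈ N₂) →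
        G.Desirable i j → G.wins U' := by
      intro i hiU' hiU hi₁ hi₂ hij
      refine ih (insert i (U.erase j)) ?_ ?_ ?_ (hij U hjU hiU hU)
      · rw [insert_sdiff_of_mem _ hiU', erase_sdiff_comm, card_erase_of_mem hj, hn]
        rfl
      · rw [card_insert_erase_inter hjU hiU hi₁, hc₁]
      · rw [card_insert_erase_inter hjU hiU hi₂, hc₂]
    have hj12 : j ∈ N₁ ∪ N₂ := hu ▸ mem_univ j
    rcases mem_union.1 hj12 with hj₁ | hj₂
    · obtain ⟨i, hi₁, hiU', hiU⟩ := find N₁ hj₁ hc₁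
      exact step i hiU' hiU (by simp [hi₁, hj₁])
        (by simp [disjoint_left.1 hd hi₁, disjoint_left.1 hd hj₁]) (h₁ i hi₁ j hj₁)
    · obtain ⟨i, hi₂, hiU', hiU⟩ := find N₂ hj₂ hc₂
      exact step i hiU' hiU (by simp [disjoint_right.1 hd hi₂, disjoint_right.1 hd hj₂])
        (by simp [hi₂, hj₂]) (h₂ i hi₂ j hj₂)

lemma IsTypePair.isGrid {G : SimpleGame N} {i j : N}
    (h : G.IsTypePair (G.typeOf i) (G.typeOf j)) :
    G.IsGrid (G.typeOf i) (G.typeOf j)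
      fun x y => G.VectorWins (G.typeOf i) (G.typeOf j) (x, y) := by
  have hd : Disjoint (G.typeOf i) (G.typeOf j) := disjoint_left.2 fun k hk hk' =>
    (h.2 k hk k hk').2 (Desirable.refl G k)
  have hu : G.typeOf i ∪ G.typeOf j = univ := by
    refine eq_univ_of_forall fun k => ?_
    have hk : G.typeOf k ∈ G.types := mem_image_of_mem _ (mem_univ k)
    have hkk : k ∈ G.typeOf k := mem_typeOf.2 ⟨Desirable.refl G k, Desirable.refl G k⟩
    rw [h.1, mem_insert, mem_singleton] at hk
    rcases hk with hk | hk
    · exact mem_union_left _ (hk ▸ hkk)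
    · exact mem_union_right _ (hk ▸ hkk)
  have hdes : ∀ a : N, ∀ k ∈ G.typeOf a, ∀ l ∈ G.typeOf a, G.Desirable k l := fun a k hk l hl =>
    (mem_typeOf.1 hk).2.trans (mem_typeOf.1 hl).1
  refine ⟨hd, hu, fun U => ⟨fun hU => ⟨U, rfl, rfl, hU⟩, ?_⟩⟩
  rintro ⟨U', h1, h2, hU'⟩
  exact wins_of_card_inter_eq hu hd (hdes i) (hdes j) U _ U' rfl h1 h2 hU'

lemma IsGrid.firstBeats_one_one {G : SimpleGame N} {N₁ N₂ : Finset N} {V : ℕ → ℕ → Prop}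
    (h : G.IsGrid N₁ N₂ V) {i j : N} (hi : i ∈ N₁) (hj : j ∈ N₂) (hji : ¬ G.Desirable j i) :
    FirstBeats N₁.card N₂.card V 1 1 := by
  unfold Desirable at hji
  push Not at hji
  obtain ⟨U, hiU, hjU, hU, hU'⟩ := hji
  have hi₂ : i ∉ N₂ := disjoint_left.1 h.disjoint hi
  have hj₁ : j ∉ N₁ := disjoint_right.1 h.disjoint hj
  have c1 : (insert j (U.erase i) ∩ N₁).card + 1 = (U ∩ N₁).card := by
    rw [insert_inter_of_notMem hj₁, erase_inter, card_erase_add_one (by simp [hi, hiU])]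
  have c2 : (insert j (U.erase i) ∩ N₂).card = (U ∩ N₂).card + 1 := by
    rw [insert_inter_of_mem hj, erase_inter, erase_eq_of_notMem (by simp [hi₂]),
      card_insert_of_notMem (by simp [hjU])]
  have l1 : (U ∩ N₁).card ≤ N₁.card := card_le_card inter_subset_right
  have l2 : (insert j (U.erase i) ∩ N₂).card ≤ N₂.card := card_le_card inter_subset_right
  rw [h.wins_iff, ← c1] at hU
  rw [h.wins_iff, c2] at hU'
  exact ⟨_, _, by omega, by omega, hU, hU'⟩

/-! ### The minimum integer representation -/

lemma IsGrid.sum_piecewise {G : SimpleGame N} {N₁ N₂ : Finset N} {V : ℕ → ℕ → Prop}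
    (h : G.IsGrid N₁ N₂ V) (w₁ w₂ : ℕ) (U : Finset N) :
    ∑ i ∈ U, (if i ∈ N₁ then (w₁ : ℤ) else w₂) =
      ((w₁ * (U ∩ N₁).card + w₂ * (U ∩ N₂).card : ℕ) : ℤ) := by
  rw [h.sum_eq, sum_congr rfl fun i hi => if_pos (mem_inter.1 hi).2,
    sum_congr (rfl : U ∩ N₂ = U ∩ N₂) fun i hi =>
      if_neg (disjoint_right.1 h.disjoint (mem_inter.1 hi).2)]
  simp [mul_comm]

end Game

end SimpleGame

open SimpleGame in
theorem mainTheorem1 {N : Type*} [Fintype N] [DecidableEq N] (G : SimpleGame N)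
    (hG : G.IsWeighted) (h_two : G.types.card = 2) :
    ∃ N₁ N₂ : Finset N, G.IsTypePair N₁ N₂ ∧
      ∃ (q : ℤ) (w : N → ℤ),
        -- `[q; w]` is the unique minimum integer representation
        G.IsMinimumIntegerRep q w ∧
        (∀ (q' : ℤ) (w' : N → ℤ), G.IsMinimumIntegerRep q' w' → q' = q ∧ w' = w) ∧
        -- its quota is smallest, too
        (∀ (q' : ℤ) (w' : N → ℤ), G.IsIntegerRep q' w' → q ≤ q') ∧
        -- it consists of a weight for each of the two types, with the stated bounds
        ∃ w₁ w₂ : ℤ, (∀ i ∈ N₁, w i = w₁) ∧ (∀ i ∈ N₂, w i = w₂) ∧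
          w₁ ≤ max ((N₁.card : ℤ) + 1) (N₂.card : ℤ) ∧
          w₂ ≤ max (N₁.card : ℤ) ((N₂.card : ℤ) - 1) ∧
          q ≤ ((N₁.card : ℤ) + (N₂.card : ℤ)) * max ((N₁.card : ℤ) + 1) (N₂.card : ℤ) ∧
          (2 ≤ (G.shiftMinimalWinning N₁ N₂).card →
            1 ≤ w₁ ∧ w₁ ≤ (N₂.card : ℤ) ∧
            0 ≤ w₂ ∧ w₂ ≤ (N₁.card : ℤ) ∧
            w₂ + 1 ≤ q ∧ q ≤ 2 * (N₁.card : ℤ) * (N₂.card : ℤ)) := by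
  obtain ⟨i₁, i₂, hpair⟩ := hG.exists_isTypePair h_two
  have hi₁ : i₁ ∈ G.typeOf i₁ := mem_typeOf.2 ⟨Desirable.refl G i₁, Desirable.refl G i₁⟩
  have hi₂ : i₂ ∈ G.typeOf i₂ := mem_typeOf.2 ⟨Desirable.refl G i₂, Desirable.refl G i₂⟩
  have hgrid := hpair.isGrid
  refine ⟨G.typeOf i₁, G.typeOf i₂, hpair, ?_⟩
  have h11 := hgrid.firstBeats_one_one hi₁ hi₂ (hpair.2 i₁ hi₁ i₂ hi₂).2
  set N₁ := G.typeOf i₁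
  set N₂ := G.typeOf i₂
  set V : ℕ → ℕ → Prop := fun x y => G.VectorWins N₁ N₂ (x, y)
  obtain ⟨ε, s, hε, hs⟩ := hG.exists_isSeparating
  obtain ⟨w₁, w₂, hw1, hwb1, hwb2, hrep, ⟨x, y, x', y', hx, hy, hx', hy', hV, hV', htight⟩,
    hforce⟩ := exists_weights
      (hgrid.mul_lt_mul_of_beats ⟨i₁, hi₁⟩ ⟨i₂, hi₂⟩ hε hs) hgrid.mono h11
  have hcard : ∀ U S : Finset N, (U ∩ S).card ≤ S.card := fun U S =>
    Finset.card_le_card Finset.inter_subset_right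
  obtain ⟨P, hP, hPx⟩ := Finset.exists_subset_card_eq hx
  obtain ⟨R, hR, hRy⟩ := Finset.exists_subset_card_eq hy
  obtain ⟨P', hP', hPx'⟩ := Finset.exists_subset_card_eq hx'
  obtain ⟨R', hR', hRy'⟩ := Finset.exists_subset_card_eq hy'
  have hwin : G.wins (P ∪ R) := by rwa [hgrid.wins_union_iff hP hR, hPx, hRy]
  have hlose : ¬ G.wins (P' ∪ R') := by rwa [hgrid.wins_union_iff hP' hR', hPx', hRy']
  set w : N → ℤ := fun i => if i ∈ N₁ then (w₁ : ℤ) else w₂ with hwdef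
  have hsum : ∀ U, ∑ i ∈ U, w i = ((w₁ * (U ∩ N₁).card + w₂ * (U ∩ N₂).card : ℕ) : ℤ) :=
    hgrid.sum_piecewise w₁ w₂
  have hsumW : ∑ i ∈ P ∪ R, w i = ((w₁ * x + w₂ * y : ℕ) : ℤ) := by
    rw [hsum, (hgrid.union_inter hP hR).1, (hgrid.union_inter hP hR).2, hPx, hRy]
  have hsumL : ∑ i ∈ P' ∪ R', w i = ((w₁ * x' + w₂ * y' : ℕ) : ℤ) := by
    rw [hsum, (hgrid.union_inter hP' hR').1, (hgrid.union_inter hP' hR').2, hPx', hRy']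
  have hR2 : ∀ i, i ∉ N₁ → i ∈ N₂ := fun i hi =>
    (Finset.mem_union.1 (hgrid.union ▸ Finset.mem_univ i)).resolve_left hi
  have hwrep : G.IsIntegerRep ((w₁ * x + w₂ * y : ℕ) : ℤ) w := by
    refine ⟨fun i => ?_, fun U hU => ?_, fun U hU => ?_⟩
    · simp only [hwdef]
      split_ifs <;> positivity
    · rw [hsum]
      have := hrep _ _ _ _ (hcard U N₁) (hcard U N₂) hx' hy' ((hgrid.wins_iff U).1 hU) hV'
      exact_mod_cast (by omega)
    · rw [hsum]
      have := hrep _ _ _ _ hx hy (hcard U N₁) (hcard U N₂) hV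
        (fun h => hU ((hgrid.wins_iff U).2 h))
      omega
  have hmin : ∀ (q' : ℤ) (w' : N → ℤ), G.IsIntegerRep q' w' → ∀ i, w i ≤ w' i := by
    intro q' w' h' i
    have key : (∀ i ∈ N₁, (w₁ : ℤ) ≤ w' i) ∧ ∀ i ∈ N₂, (w₂ : ℤ) ≤ w' i := by
      rcases hforce with ⟨rfl, rfl⟩ | ⟨p, r, p', r', hb, hb', hdet, rfl, rfl⟩
      · refine ⟨fun i hi => ?_, fun i _ => by simpa using h'.1 i⟩
        have h1 := hgrid.sum_lt_of_firstBeats h'.isSeparating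
          (Finset.singleton_subset_iff.2 hi) (Finset.singleton_subset_iff.2 hi₂)
          (by simpa using h11)
        simp only [Finset.sum_singleton] at h1
        have h2 : w' i₂ + 1 ≤ w' i := by exact_mod_cast h1
        have h3 := h'.1 i₂
        push_cast
        omega
      · exact hgrid.le_weight ⟨i₁, hi₁⟩ ⟨i₂, hi₂⟩ h' hb hb' hdet
    simp only [hwdef]
    split_ifs with hi
    · exact key.1 i hi
    · exact key.2 i (hR2 i hi)
  have hquota : ∀ (q' : ℤ) (w' : N → ℤ), G.IsIntegerRep q' w' →
      ((w₁ * x + w₂ * y : ℕ) : ℤ) ≤ q' := by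
    intro q' w' h'
    have h1 := h'.2.2 _ hlose
    have h2 : ∑ i ∈ P' ∪ R', w i ≤ ∑ i ∈ P' ∪ R', w' i :=
      Finset.sum_le_sum fun i _ => hmin q' w' h' i
    omega
  have hn1 : 1 ≤ N₁.card := Finset.card_pos.2 ⟨i₁, hi₁⟩
  have hn2 : 1 ≤ N₂.card := Finset.card_pos.2 ⟨i₂, hi₂⟩
  -- A single voter of the second type loses: otherwise all non-empty coalitions would win.
  have hlose1 : ¬ V 0 1 := by
    obtain ⟨a, b, ha, hb, -, hl⟩ := h11
    exact fun h => hl (hgrid.mono 0 1 a (b + 1) (by omega) (by omega) (by omega) hb h)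
  have hq1 : w₂ + 1 ≤ w₁ * x + w₂ * y := by
    have := hrep _ _ _ _ hx hy (Nat.zero_le _) hn2 hV hlose1
    omega
  have h1x : w₁ * x ≤ N₂.card * N₁.card := Nat.mul_le_mul hwb1 hx
  have h2y : w₂ * y ≤ N₁.card * N₂.card := Nat.mul_le_mul hwb2 hy
  refine ⟨((w₁ * x + w₂ * y : ℕ) : ℤ), w, ⟨hwrep, hmin⟩, ?_, hquota, w₁, w₂, ?_, ?_, ?_, ?_, ?_,
    fun _ => ⟨by exact_mod_cast hw1, by exact_mod_cast hwb1, by positivity,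
      by exact_mod_cast hwb2, by exact_mod_cast hq1, ?_⟩⟩
  · rintro q' w' ⟨h', hm'⟩
    have hww : w' = w := funext fun i => le_antisymm (hm' _ _ hwrep i) (hmin _ _ h' i)
    refine ⟨le_antisymm ?_ (hquota _ _ h'), hww⟩
    have := h'.2.1 _ hwin
    rwa [hww, hsumW] at this
  · intro i hi
    simp [hwdef, hi]
  · intro i hi
    simp [hwdef, Finset.disjoint_right.1 hgrid.disjoint hi]
  · exact le_max_of_le_right (by exact_mod_cast hwb1)
  · exact le_max_of_le_left (by exact_mod_cast hwb2)
  · -- Here `w₁ * x ≤ n₁ * n₂` and `w₂ * y ≤ n₂ * n₁ ≤ n₂ * (n₁ + 1)`.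
    zify at h1x h2y
    have h3 : (N₁.card : ℤ) * N₂.card ≤
        N₁.card * max ((N₁.card : ℤ) + 1) (N₂.card : ℤ) :=
      mul_le_mul_of_nonneg_left (le_max_right _ _) (by positivity)
    have h4 : (N₂.card : ℤ) * (N₁.card + 1) ≤
        N₂.card * max ((N₁.card : ℤ) + 1) (N₂.card : ℤ) :=
      mul_le_mul_of_nonneg_left (le_max_left _ _) (by positivity)
    push_cast
    linarith
  · zify at h1x h2y
    push_cast
    linarith
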